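/- Let $d\ge 1$ and let $Y=(Y_t)_{t\in\mathbb Z^d}$ be a $\{0,1\}$-valued random field on a probability space $(\Omega,\mathcal F,P)$ that is stationary (its finite-dimensional distributions are invariant under all shifts of $\mathbb Z^d$) and ergodic (for every measurable set $A\subset\mathbb R^{\mathbb Z^d}$ that is invariant under all shifts, $P(Y\in A)\in\{0,1\}$), and suppose $\mathbb E Y_0\neq 0$. Put $$\Gamma_n:=\{t\in[-n,n)^d\cap\mathbb Z^d : Y_t=1\}.$$ Then for every $l\in\mathbb Z^d$ $$\frac{|\{(t,s)\in\Gamma_n\times\Gamma_n : t-s=l\}|}{|\Gamma_n|}\longrightarrow\frac{\mathbb E[Y_lY_0]}{\mathbb E[Y_0]}\qquad\text{almost surely as } n\to\infty .$$ In particular, almost surely the finite sets $\Gamma_n$ satisfy: (a) $\Gamma_n\subset\Gamma_{n+1}$ for every $n$; (b) $|\Gamma_n|\to\infty$ as $n\to\infty$; (c) for every $l\in\mathbb Z^d$ the quotient $|\{(t,s)\in\Gamma_n\times\Gamma_n : t-s=l\}|/|\Gamma_n|$ converges as $n\to\infty$ to some real number $a_l$. (The quotient is read as $0$ when $\Gamma_n$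 is empty.) -/

import Mathlib

open MeasureTheory Filter Topology

/-- A random field `Y = (Y_t)`, `t ∈ ℤ^d`, is (strictly) stationary under `P` if its
finite dimensional distributions are shift invariant. -/
def IsStationaryField {d : ℕ} {Ω : Type*} [MeasurableSpace Ω] (P : Measure Ω)
    (Y : (Fin d → ℤ) → Ω → ℝ) : Prop :=
  ∀ (h : Fin d → ℤ) (I : Finset (Fin d → ℤ)),
    P.map (fun ω (t : I) => Y ((t : Fin d → ℤ) + h) ω) =
      P.map (fun ω (t : I) => Y (t : Fin d → ℤ) ω)

/-- A random field on `ℤ^d` is ergodic under `P` if every event `{Y ∈ A}`, where `A` is a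
measurable subset of path space invariant under all shifts by elements of `ℤ^d`,
has probability `0` or `1`. -/
def IsErgodicField {d : ℕ} {Ω : Type*} [MeasurableSpace Ω] (P : Measure Ω)
    (Y : (Fin d → ℤ) → Ω → ℝ) : Prop :=
  ∀ A : Set ((Fin d → ℤ) → ℝ), MeasurableSet A →
    (∀ h : Fin d → ℤ, (fun (y : (Fin d → ℤ) → ℝ) (t : Fin d → ℤ) => y (t + h)) ⁻¹' A = A) →
    P {ω | (fun t => Y t ω) ∈ A} = 0 ∨ P {ω | (fun t => Y t ω) ∈ A} = 1

open Classical in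
/-- The random sampling set `Γ_n(ω) = {t ∈ [-n, n)^d ∩ ℤ^d : Y_t(ω) = 1}`. -/
noncomputable def sampleSet {d : ℕ} {Ω : Type*} (Y : (Fin d → ℤ) → Ω → ℝ) (n : ℕ) (ω : Ω) :
    Finset (Fin d → ℤ) :=
  (Fintype.piFinset (fun _ : Fin d => Finset.Ico (-(n : ℤ)) (n : ℤ))).filter
    (fun t => Y t ω = 1)

/-- The lag-pair frequency `|{(t, s) ∈ Γ × Γ : t - s = l}| / |Γ|` of a finite set `Γ ⊆ ℤ^d`
(with value `0` if `Γ` is empty). -/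
noncomputable def lagFreq {d : ℕ} (Γ : Finset (Fin d → ℤ)) (l : Fin d → ℤ) : ℝ :=
  (((Γ ×ˢ Γ).filter (fun p => p.1 - p.2 = l)).card : ℝ) / (Γ.card : ℝ)

/-- The conditions imposed on a sequence of (finite) sampling sets: it is increasing, the
cardinalities tend to infinity, and all lag-pair frequencies converge. -/
structure IsSamplingSequence {d : ℕ} (Γ : ℕ → Finset (Fin d → ℤ)) : Prop where
  subset_succ : ∀ n, Γ n ⊆ Γ (n + 1)
  card_tendsto : Tendsto (fun n => (Γ n).card) atTop atTop
  lagFreq_tendsto : ∀ l : Fin d → ℤ, ∃ a : ℝ, Tendsto (fun n => lagFreq (Γ n) l) atTop (𝓝 a)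

/-! Divide the number of lag pairs and `|Γ_n|` by the volume of the cube. Both become averages over
the cube, along the shift orbit of the path of `Y`, of bounded functions: the indicators of `{y_0 =
y_l = 1}` and `{y_0 = 1}`. The only error comes from pairs with one site outside the cube, a
boundary effect of density zero. The pointwise ergodic theorem `ae_tendsto_cubeAverage` gives the
limits `E[Y_l Y_0]` and `E[Y_0]`; since `E[Y_0] > 0`, the quotient converges and `|Γ_n|` grows like
the volume.

The ergodic theorem rests on two facts. By a Hilbert space argument, ergodicity makes a bounded
function minus its mean an `L¹` limit of functions whose averages tend to zero
(`exists_lintegral_sub_le_of_ergodicVAdd`). The maximal inequality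
`mul_measure_exists_le_cubeAverage_le`, obtained from a Vitali covering, shows that a remainder
small in `L¹` has large averages only on a set of small measure. -/

open scoped ENNReal

/-! ### Lattice cubes: covering and boundary estimates -/

/-- The discrete cube `[-n, n)^d` in `ℤ^d`. -/
noncomputable def latticeCube (d n : ℕ) : Finset (Fin d → ℤ) :=
  Fintype.piFinset (fun _ : Fin d => Finset.Ico (-(n : ℤ)) (n : ℤ))

theorem mem_latticeCube {d n : ℕ} {t : Fin d → ℤ} :
    t ∈ latticeCube d n ↔ ∀ i, -(n : ℤ) ≤ t i ∧ t i < n := by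
  simp [latticeCube]

theorem card_latticeCube (d n : ℕ) : (latticeCube d n).card = (2 * n) ^ d := by
  simp only [latticeCube, Fintype.card_piFinset_const, Int.card_Ico]
  congr 1
  omega

theorem latticeCube_mono (d : ℕ) : Monotone (latticeCube d) := by
  intro m n h t ht
  rw [mem_latticeCube] at *
  intro i
  have := ht i
  omega

/-- A Vitali-type covering estimate on `ℤ^d`: if every point `t` of a finite set `E` is the
centre of a cube on which the average of `a` is at least `c`, then `c * |E|` is controlled by
the total mass of `a` near `E`. -/
theorem mul_card_le_of_cube_averages {d : ℕ} (a : (Fin d → ℤ) → ℝ≥0∞) (E F : Finset (Fin d → ℤ))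
    (r : (Fin d → ℤ) → ℕ) (hr : ∀ t ∈ E, 0 < r t) (c : ℝ≥0∞)
    (hF : ∀ t ∈ E, ∀ s ∈ latticeCube d (r t), t + s ∈ F)
    (h : ∀ t ∈ E, c * (latticeCube d (r t)).card ≤ ∑ s ∈ latticeCube d (r t), a (t + s)) :
    c * E.card ≤ 3 ^ d * ∑ s ∈ F, a s := by
  classical
  let B : (Fin d → ℤ) → Finset (Fin d → ℤ) := fun t =>
    (latticeCube d (r t)).map (addLeftEmbedding t)
  have hB : ∀ t s, s ∈ B t ↔ ∀ i, t i - r t ≤ s i ∧ s i < t i + r t := by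
    intro t s
    simp only [B, Finset.mem_map, addLeftEmbedding_apply, mem_latticeCube]
    constructor
    · rintro ⟨u, hu, rfl⟩ i
      have := hu i
      simp only [Pi.add_apply]
      omega
    · intro hs
      refine ⟨s - t, fun i => ?_, by simp⟩
      have := hs i
      simp only [Pi.sub_apply]
      omega
  -- The chosen cubes are disjoint, and each cube meets a chosen one of at least half its radius.
  -- Only the centres have to be covered, so enlarging the chosen cubes by `1 + 2 = 3` is enough.
  obtain ⟨u, huE, hdisj, hcov⟩ := Vitali.exists_disjoint_subfamily_covering_enlargement
    (fun t => (B t : Set (Fin d → ℤ))) (E : Set (Fin d → ℤ)) (fun t => (r t : ℝ)) 2 one_lt_two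
    (fun _ _ => by positivity) (∑ t ∈ E, (r t : ℝ))
    (fun t ht => Finset.single_le_sum (f := fun t => (r t : ℝ)) (fun _ _ => by positivity) ht)
    (fun t ht => ⟨t, by
      have := hr t ht
      simp only [Finset.mem_coe, hB]
      omega⟩)
  lift u to Finset (Fin d → ℤ) using E.finite_toSet.subset huE
  simp only [Finset.coe_subset] at huE
  have hsub : E ⊆ u.biUnion fun b => (latticeCube d (3 * r b)).map (addLeftEmbedding b) := by
    intro t ht
    obtain ⟨b, hb, ⟨s, hs1, hs2⟩, hle⟩ := hcov t ht
    simp only [Finset.mem_biUnion, Finset.mem_map, addLeftEmbedding_apply, mem_latticeCube]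
    refine ⟨b, hb, t - b, fun i => ?_, by simp⟩
    have hle' : r t ≤ 2 * r b := by exact_mod_cast hle
    have h1 := (hB t s).1 hs1 i
    have h2 := (hB b s).1 hs2 i
    simp only [Pi.sub_apply]
    push_cast
    omega
  have hcard : E.card ≤ 3 ^ d * ∑ b ∈ u, (latticeCube d (r b)).card := by
    refine (Finset.card_le_card hsub).trans (Finset.card_biUnion_le.trans ?_)
    rw [Finset.mul_sum]
    refine Finset.sum_le_sum fun b _ => ?_
    rw [Finset.card_map, card_latticeCube, card_latticeCube, ← mul_pow]
    exact le_of_eq (by ring)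
  calc c * E.card ≤ c * ((3 ^ d * ∑ b ∈ u, (latticeCube d (r b)).card : ℕ) : ℝ≥0∞) := by
        gcongr
    _ = 3 ^ d * ∑ b ∈ u, c * (latticeCube d (r b)).card := by
        rw [← Finset.mul_sum]
        push_cast
        ring
    _ ≤ 3 ^ d * ∑ b ∈ u, ∑ s ∈ B b, a s := by
        gcongr with b hb
        rw [Finset.sum_map]
        exact h b (huE hb)
    _ = 3 ^ d * ∑ s ∈ u.biUnion B, a s := by
        rw [Finset.sum_biUnion]
        intro x hx y hy hxy
        exact Finset.disjoint_coe.1 (hdisj hx hy hxy)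
    _ ≤ 3 ^ d * ∑ s ∈ F, a s := by
        gcongr
        intro s hs
        obtain ⟨b, hb, hs⟩ := Finset.mem_biUnion.1 hs
        obtain ⟨v, hv, rfl⟩ := Finset.mem_map.1 hs
        exact hF b (huE hb) v hv

/-- The proportion of the cube `[-n, n)^d` that leaves it under a fixed translation tends to zero. -/
theorem tendsto_card_boundary_div {d : ℕ} (h : Fin d → ℤ) :
    Tendsto (fun n : ℕ => (((latticeCube d n).filter (fun t => t + h ∉ latticeCube d n)).card : ℝ) /
      (latticeCube d n).card) atTop (𝓝 0) := by
  -- `k` bounds every coordinate of `h`, so only points outside the cube of radius `n - k` can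
  -- leave.
  set k : ℕ := ∑ i, (h i).natAbs with hk
  have hki : ∀ i, (h i).natAbs ≤ k := fun i =>
    Finset.single_le_sum (f := fun i => (h i).natAbs) (fun _ _ => Nat.zero_le _) (Finset.mem_univ i)
  have hlim : Tendsto (fun n : ℕ => 1 - (1 - (k : ℝ) / n) ^ d) atTop (𝓝 0) := by
    have h1 : Tendsto (fun n : ℕ => (k : ℝ) / n) atTop (𝓝 0) := tendsto_const_div_atTop_nhds_zero_nat _
    have := ((h1.const_sub 1).pow d).const_sub 1
    simpa using this
  refine squeeze_zero' (Eventually.of_forall fun n => by positivity) ?_ hlim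
  filter_upwards [eventually_ge_atTop (k + 1)] with n hn
  have hn0 : (0 : ℝ) < n := by exact_mod_cast (by omega : 0 < n)
  have hsub : (latticeCube d n).filter (fun t => t + h ∉ latticeCube d n) ⊆
      latticeCube d n \ latticeCube d (n - k) := by
    intro t ht
    rw [Finset.mem_filter] at ht
    refine Finset.mem_sdiff.2 ⟨ht.1, fun hmem => ht.2 ?_⟩
    rw [mem_latticeCube] at hmem ⊢
    intro i
    have h1 := hmem i
    have h2 := hki i
    simp only [Pi.add_apply]
    omega
  have hcard := Finset.card_le_card hsub
  rw [Finset.card_sdiff_of_subset (latticeCube_mono d (Nat.sub_le n k))] at hcard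
  have hle := Finset.card_le_card (latticeCube_mono d (Nat.sub_le n k))
  have hcard' : (((latticeCube d n).filter (fun t => t + h ∉ latticeCube d n)).card : ℝ) ≤
      (2 * n) ^ d - (2 * (n - k)) ^ d := by
    have : (((latticeCube d n).filter (fun t => t + h ∉ latticeCube d n)).card : ℝ) ≤
      (((latticeCube d n).card - (latticeCube d (n - k)).card : ℕ) : ℝ) := by exact_mod_cast hcard
    rw [Nat.cast_sub hle, card_latticeCube, card_latticeCube] at this
    push_cast [Nat.cast_sub (by omega : k ≤ n)] at this
    exact this
  rw [div_le_iff₀ (by rw [card_latticeCube]; exact_mod_cast pow_pos (by omega) d),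
    card_latticeCube]
  refine hcard'.trans (le_of_eq ?_)
  push_cast
  rw [sub_mul, one_mul, ← mul_pow]
  congr 2
  field_simp

/-! ### Orbit averages and the maximal inequality -/

section Averages

variable {d : ℕ} {X : Type*}

/-- The average of `f` along the part of the orbit of `x` indexed by `[-n, n)^d`. -/
noncomputable def cubeAverage [AddAction (Fin d → ℤ) X] (f : X → ℝ) (n : ℕ) (x : X) : ℝ :=
  (∑ t ∈ latticeCube d n, f (t +ᵥ x)) / (latticeCube d n).card

variable [AddAction (Fin d → ℤ) X]

theorem cubeAverage_add (f g : X → ℝ) (n : ℕ) (x : X) :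
    cubeAverage (d := d) (f + g) n x = cubeAverage (d := d) f n x + cubeAverage (d := d) g n x := by
  simp only [cubeAverage, Pi.add_apply, Finset.sum_add_distrib, add_div]

theorem cubeAverage_sub (f g : X → ℝ) (n : ℕ) (x : X) :
    cubeAverage (d := d) (f - g) n x = cubeAverage (d := d) f n x - cubeAverage (d := d) g n x := by
  simp only [cubeAverage, Pi.sub_apply, Finset.sum_sub_distrib, sub_div]

theorem cubeAverage_smul (c : ℝ) (f : X → ℝ) (n : ℕ) (x : X) :
    cubeAverage (d := d) (c • f) n x = c * cubeAverage (d := d) f n x := by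
  simp only [cubeAverage, Pi.smul_apply, smul_eq_mul, ← Finset.mul_sum, mul_div_assoc]

theorem cubeAverage_const (c : ℝ) {n : ℕ} (hn : 0 < n) (x : X) :
    cubeAverage (d := d) (fun _ => c) n x = c := by
  have : ((latticeCube d n).card : ℝ) ≠ 0 := by
    rw [card_latticeCube]
    positivity
  simp only [cubeAverage, Finset.sum_const, nsmul_eq_mul]
  field_simp

theorem abs_cubeAverage_le (f : X → ℝ) (n : ℕ) (x : X) :
    |cubeAverage (d := d) f n x| ≤ cubeAverage (d := d) (fun y => |f y|) n x := by
  simp only [cubeAverage, abs_div, Nat.abs_cast]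
  gcongr
  exact Finset.abs_sum_le_sum_abs _ _

/-- Translating the index set along a bounded sequence changes averages over cubes by a
vanishing amount. -/
theorem tendsto_sum_translate_sub_div (a : (Fin d → ℤ) → ℝ) {C : ℝ} (ha : ∀ t, |a t| ≤ C)
    (h : Fin d → ℤ) :
    Tendsto (fun n : ℕ => (∑ t ∈ latticeCube d n, a (t + h) - ∑ t ∈ latticeCube d n, a t) /
      (latticeCube d n).card) atTop (𝓝 0) := by
  classical
  have hC : 0 ≤ C := (abs_nonneg _).trans (ha 0)
  have key : ∀ n, |∑ t ∈ latticeCube d n, a (t + h) - ∑ t ∈ latticeCube d n, a t| ≤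
      C * ((latticeCube d n).filter (fun t => t + h ∉ latticeCube d n)).card +
      C * ((latticeCube d n).filter (fun t => t + -h ∉ latticeCube d n)).card := by
    intro n
    set Q := latticeCube d n
    have h1 := Finset.sum_filter_add_sum_filter_not Q (fun t => t + h ∈ Q) (fun t => a (t + h))
    have h2 := Finset.sum_filter_add_sum_filter_not Q (fun t => t + -h ∈ Q) a
    -- The terms that stay in the cube cancel, leaving two boundary sums.
    have h3 : ∑ t ∈ Q with t + h ∈ Q, a (t + h) = ∑ t ∈ Q with t + -h ∈ Q, a t := by
      refine Finset.sum_nbij' (fun t => t + h) (fun t => t + -h) ?_ ?_ ?_ ?_ ?_ <;>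
        simp +contextual
    have hbd : ∀ (S : Finset (Fin d → ℤ)) (b : (Fin d → ℤ) → ℝ), (∀ t, |b t| ≤ C) →
        |∑ t ∈ S, b t| ≤ C * S.card := by
      intro S b hb
      refine (Finset.abs_sum_le_sum_abs _ _).trans ((Finset.sum_le_card_nsmul _ _ C
        fun t _ => hb t).trans (le_of_eq ?_))
      rw [nsmul_eq_mul, mul_comm]
    have h4 := hbd {t ∈ Q | t + h ∉ Q} (fun t => a (t + h)) (fun t => ha _)
    have h5 := hbd {t ∈ Q | t + -h ∉ Q} a ha
    rw [← h1, ← h2, h3, add_sub_add_left_eq_sub]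
    exact (abs_sub _ _).trans (add_le_add h4 h5)
  have hlim := ((tendsto_card_boundary_div h).const_mul C).add
    ((tendsto_card_boundary_div (-h)).const_mul C)
  simp only [mul_zero, add_zero] at hlim
  refine squeeze_zero_norm (fun n => ?_) hlim
  rw [Real.norm_eq_abs, abs_div, Nat.abs_cast, ← mul_div_assoc, ← mul_div_assoc, ← add_div]
  gcongr
  exact key n

/-- Boundedness reduces this to the boundary estimate along the orbit. It holds at every point, so
differences of a bounded function and its translates lie in `vanishingAverages`. -/
theorem tendsto_cubeAverage_coboundary (f : X → ℝ) {C : ℝ} (hf : ∀ x, |f x| ≤ C) (h : Fin d → ℤ)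
    (x : X) :
    Tendsto (fun n => cubeAverage (d := d) ((fun y => f (h +ᵥ y)) - f) n x) atTop (𝓝 0) := by
  convert tendsto_sum_translate_sub_div (fun t => f (t +ᵥ x)) (fun t => hf _) h using 2 with n
  rw [cubeAverage_sub, cubeAverage, cubeAverage, ← sub_div]
  simp only [add_comm _ h, add_vadd]

variable [MeasurableSpace X] [MeasurableConstVAdd (Fin d → ℤ) X] {μ : Measure X}
  [VAddInvariantMeasure (Fin d → ℤ) X μ]

/-- Wiener's maximal inequality for cubes of bounded size. -/
theorem mul_measure_exists_le_cube_average_le (f : X → ℝ≥0∞) (hf : Measurable f) (c : ℝ≥0∞)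
    (N : ℕ) :
    c * μ {x | ∃ n, 0 < n ∧ n ≤ N ∧
      c * (latticeCube d n).card ≤ ∑ s ∈ latticeCube d n, f (s +ᵥ x)} ≤ 6 ^ d * ∫⁻ x, f x ∂μ := by
  classical
  rcases Nat.eq_zero_or_pos N with rfl | hN
  · rw [show {x | ∃ n, 0 < n ∧ n ≤ 0 ∧ c * (latticeCube d n).card ≤
      ∑ s ∈ latticeCube d n, f (s +ᵥ x)} = ∅ by
        ext x
        refine iff_of_false ?_ (Set.notMem_empty x)
        rintro ⟨n, h0, h1, -⟩
        omega]
    simp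
  set S := {x | ∃ n, 0 < n ∧ n ≤ N ∧
      c * (latticeCube d n).card ≤ ∑ s ∈ latticeCube d n, f (s +ᵥ x)} with hS
  have hSm : MeasurableSet S := by
    have : S = ⋃ n, ⋃ (_ : 0 < n ∧ n ≤ N), {x | c * (latticeCube d n).card ≤
        ∑ s ∈ latticeCube d n, f (s +ᵥ x)} := by
      ext x
      simp [hS, and_assoc]
    rw [this]
    refine MeasurableSet.iUnion fun n => MeasurableSet.iUnion fun _ => ?_
    exact measurableSet_le measurable_const
      (Finset.measurable_sum _ fun s _ => hf.comp (measurable_const_vadd s))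
  -- Transference: the covering estimate is applied on the orbit of `x`. Windows of radius at most
  -- `N` around the cube of radius `N` stay in that of radius `2 * N`; this volume ratio `2 ^ d`
  -- times the covering constant `3 ^ d` gives `6 ^ d`.
  have hpt : ∀ x, ∑ t ∈ latticeCube d N, c * S.indicator 1 (t +ᵥ x) ≤
      3 ^ d * ∑ s ∈ latticeCube d (2 * N), f (s +ᵥ x) := by
    intro x
    set E := (latticeCube d N).filter (fun t => t +ᵥ x ∈ S) with hE
    have hEs : ∀ t, ∃ n, t ∈ E → 0 < n ∧ n ≤ N ∧
        c * (latticeCube d n).card ≤ ∑ s ∈ latticeCube d n, f (s +ᵥ (t +ᵥ x)) := by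
      intro t
      by_cases ht : t ∈ E
      · obtain ⟨n, hn⟩ := (Finset.mem_filter.1 ht).2
        exact ⟨n, fun _ => hn⟩
      · exact ⟨0, fun h => absurd h ht⟩
    choose r hr using hEs
    have := mul_card_le_of_cube_averages (fun t => f (t +ᵥ x)) E (latticeCube d (2 * N)) r
      (fun t ht => (hr t ht).1) c (fun t ht s hs => by
        have h1 := (hr t ht).2.1
        have h2 := mem_latticeCube.1 (Finset.mem_filter.1 ht).1
        rw [mem_latticeCube] at hs ⊢
        intro i
        have h2 := h2 i
        have h3 := hs i
        simp only [Pi.add_apply]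
        push_cast
        omega) (fun t ht => by
        simp only [add_comm t, add_vadd]
        exact (hr t ht).2.2)
    refine le_trans (le_of_eq ?_) this
    rw [← Finset.mul_sum, hE, Finset.card_filter]
    push_cast
    simp [Set.indicator_apply]
  have hint : ∫⁻ x, ∑ t ∈ latticeCube d N, c * S.indicator 1 (t +ᵥ x) ∂μ ≤
      ∫⁻ x, 3 ^ d * ∑ s ∈ latticeCube d (2 * N), f (s +ᵥ x) ∂μ := lintegral_mono hpt
  have hind : Measurable (S.indicator (1 : X → ℝ≥0∞)) := measurable_one.indicator hSm
  have hinv : ∀ (g : X → ℝ≥0∞) (t : Fin d → ℤ), Measurable g →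
      ∫⁻ x, g (t +ᵥ x) ∂μ = ∫⁻ x, g x ∂μ := fun g t hg =>
    (measurePreserving_vadd t μ).lintegral_comp hg
  rw [lintegral_finsetSum (f := fun t x => c * S.indicator 1 (t +ᵥ x)) _
      fun t _ => (hind.comp (measurable_const_vadd t)).const_mul c,
    lintegral_const_mul' _ _ (by finiteness),
    lintegral_finsetSum (f := fun s x => f (s +ᵥ x)) _ fun s _ => hf.comp (measurable_const_vadd s)] at hint
  have hSint : ∀ t : Fin d → ℤ, ∫⁻ x, c * S.indicator 1 (t +ᵥ x) ∂μ = c * μ S := fun t => by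
    rw [hinv (fun x => c * S.indicator 1 x) t (hind.const_mul c), lintegral_const_mul c hind,
      lintegral_indicator_one hSm]
  simp only [hinv f _ hf, hSint, Finset.sum_const, nsmul_eq_mul] at hint
  have hcN : ((latticeCube d N).card : ℝ≥0∞) ≠ 0 := by
    rw [card_latticeCube]
    exact_mod_cast (by positivity : (2 * N) ^ d ≠ 0)
  rw [← ENNReal.mul_le_mul_iff_right hcN (ENNReal.natCast_ne_top _)]
  refine hint.trans (le_of_eq ?_)
  rw [card_latticeCube, card_latticeCube]
  push_cast
  rw [show (6 : ℝ≥0∞) = 3 * 2 by norm_num]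
  simp only [mul_pow]
  ring

/-- Wiener's maximal inequality for actions of `ℤ^d`. -/
theorem mul_measure_exists_le_cubeAverage_le (f : X → ℝ) (hf : Measurable f) (hf0 : ∀ x, 0 ≤ f x)
    {c : ℝ} (hc : 0 ≤ c) :
    ENNReal.ofReal c * μ {x | ∃ n, 0 < n ∧ c ≤ cubeAverage (d := d) f n x} ≤
      6 ^ d * ∫⁻ x, ENNReal.ofReal (f x) ∂μ := by
  let S : ℕ → Set X := fun N => {x | ∃ n, 0 < n ∧ n ≤ N ∧
      ENNReal.ofReal c * (latticeCube d n).card ≤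
        ∑ s ∈ latticeCube d n, ENNReal.ofReal (f (s +ᵥ x))}
  have hmono : Monotone S := fun M N hMN x ⟨n, h0, h1, h2⟩ => ⟨n, h0, h1.trans hMN, h2⟩
  have hU : {x | ∃ n, 0 < n ∧ c ≤ cubeAverage (d := d) f n x} ⊆ ⋃ N, S N := by
    rintro x ⟨n, h0, h1⟩
    refine Set.mem_iUnion.2 ⟨n, n, h0, le_rfl, ?_⟩
    have hpos : (0 : ℝ) < (latticeCube d n).card := by
      rw [card_latticeCube]
      positivity
    rw [cubeAverage, le_div_iff₀ hpos] at h1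
    rw [← ENNReal.ofReal_sum_of_nonneg fun s _ => hf0 _, ← ENNReal.ofReal_natCast,
      ← ENNReal.ofReal_mul hc]
    exact ENNReal.ofReal_le_ofReal h1
  refine (mul_le_mul_right (measure_mono hU) _).trans ?_
  rw [hmono.measure_iUnion, ENNReal.mul_iSup]
  exact iSup_le fun N => mul_measure_exists_le_cube_average_le _ hf.ennreal_ofReal _ N

end Averages

/-! ### The pointwise ergodic theorem -/

section PointwiseErgodic

variable {d : ℕ} {X : Type*} [MeasurableSpace X]

/-- Each preimage of a measurable set is almost invariant, hence null or conull, and countably many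
measurable sets separate the points of `ℝ`. -/
theorem ErgodicVAdd.exists_ae_eq_const {G : Type*} [VAdd G X] {μ : Measure X} [ErgodicVAdd G X μ]
    {g : X → ℝ} (hg : Measurable g) (hinv : ∀ h : G, (fun x => g (h +ᵥ x)) =ᵐ[μ] g) :
    ∃ c, g =ᵐ[μ] Function.const X c := by
  refine exists_eventuallyEq_const_of_forall_separating MeasurableSet fun U hU => ?_
  refine eventuallyConst_set.1 (ErgodicVAdd.aeconst_of_forall_preimage_vadd_ae_eq (G := G)
    (hg hU) fun h => ?_)
  filter_upwards [hinv h] with x hx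
  exact congrArg (· ∈ U) hx

variable [AddAction (Fin d → ℤ) X] [MeasurableConstVAdd (Fin d → ℤ) X] (μ : Measure X)
  [IsProbabilityMeasure μ]

variable (d) in
/-- The square integrable classes with a mean zero representative all of whose averages over
cubes tend to zero. -/
def vanishingAverages : Submodule ℝ (Lp ℝ 2 μ) where
  carrier := {φ | ∃ g : X → ℝ, Measurable g ∧ φ =ᵐ[μ] g ∧ ∫ x, g x ∂μ = 0 ∧
    ∀ x, Tendsto (fun n => cubeAverage (d := d) g n x) atTop (𝓝 0)}
  zero_mem' := ⟨0, measurable_zero, Lp.coeFn_zero _ _ _, by simp, fun x => by simp [cubeAverage]⟩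
  add_mem' := by
    rintro φ ψ ⟨g, hg, hφ, hg0, hgt⟩ ⟨k, hk, hψ, hk0, hkt⟩
    refine ⟨g + k, hg.add hk, (Lp.coeFn_add φ ψ).trans (hφ.add hψ), ?_, fun x => ?_⟩
    · have h1 := ((Lp.memLp φ).ae_eq hφ).integrable one_le_two
      have h2 := ((Lp.memLp ψ).ae_eq hψ).integrable one_le_two
      rw [integral_add' h1 h2, hg0, hk0, add_zero]
    · simpa only [cubeAverage_add, add_zero] using (hgt x).add (hkt x)
  smul_mem' := by
    rintro c φ ⟨g, hg, hφ, hg0, hgt⟩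
    refine ⟨c • g, hg.const_smul c, (Lp.coeFn_smul c φ).trans (hφ.const_smul c), ?_, fun x => ?_⟩
    · simp [integral_const_mul, hg0]
    · simpa only [cubeAverage_smul, mul_zero] using (hgt x).const_mul c

/-- Under an ergodic action, a bounded function is, up to a
constant, an `L²` limit of functions with vanishing averages. -/
theorem exists_sub_const_mem_closure_vanishingAverages [ErgodicVAdd (Fin d → ℤ) X μ]
    (f : X → ℝ) (hf : Measurable f) {C : ℝ} (hC : ∀ x, |f x| ≤ C) (hf2 : MemLp f 2 μ) :
    ∃ c, hf2.toLp f - Lp.const 2 μ c ∈ (vanishingAverages d μ).topologicalClosure := by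
  set B := vanishingAverages d μ
  set S := B.topologicalClosure
  set F := hf2.toLp f
  let U : (Fin d → ℤ) → Lp ℝ 2 μ →ₗᵢ[ℝ] Lp ℝ 2 μ := fun h =>
    Lp.compMeasurePreservingₗᵢ ℝ (fun x : X => h +ᵥ x) (measurePreserving_vadd h μ)
  have hU : ∀ h (φ : Lp ℝ 2 μ), U h φ =ᵐ[μ] fun x => φ (h +ᵥ x) := fun h φ =>
    Lp.coeFn_compMeasurePreserving φ (measurePreserving_vadd h μ)
  have hcomp : ∀ (h : Fin d → ℤ) {φ ψ : X → ℝ}, φ =ᵐ[μ] ψ → (fun x => φ (h +ᵥ x)) =ᵐ[μ] fun x => ψ (h +ᵥ x) :=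
    fun h φ ψ hφ => (measurePreserving_vadd h μ).quasiMeasurePreserving.ae_eq_comp hφ
  have hint : ∀ (h : Fin d → ℤ) {g : X → ℝ}, Measurable g → ∫ x, g (h +ᵥ x) ∂μ = ∫ x, g x ∂μ := by
    intro h g hg
    rw [← (measurePreserving_vadd h μ).map_eq, integral_map (measurable_const_vadd h).aemeasurable
      hg.aestronglyMeasurable, (measurePreserving_vadd h μ).map_eq]
  have hUB : ∀ h, ∀ φ ∈ B, U h φ ∈ B := by
    rintro h φ ⟨g, hg, hφ, hg0, hgt⟩
    refine ⟨fun x => g (h +ᵥ x), hg.comp (measurable_const_vadd h), (hU h φ).trans (hcomp h hφ),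
      (hint h hg).trans hg0, fun x => ?_⟩
    refine (hgt (h +ᵥ x)).congr fun n => ?_
    simp only [cubeAverage, ← add_vadd, add_comm h]
  have hUS : ∀ h, ∀ φ ∈ S, U h φ ∈ S := fun h φ hφ =>
    map_mem_closure (U h).continuous hφ (hUB h)
  have hUF : ∀ h, U h F - F ∈ B := by
    intro h
    refine ⟨(fun x => f (h +ᵥ x)) - f, (hf.comp (measurable_const_vadd h)).sub hf, ?_, ?_,
      tendsto_cubeAverage_coboundary f hC h⟩
    · exact (Lp.coeFn_sub _ _).trans
        (((hU h F).trans (hcomp h hf2.coeFn_toLp)).sub hf2.coeFn_toLp)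
    · have h1 := hf2.integrable one_le_two
      rw [integral_sub' (f := fun x => f (h +ᵥ x))
          ((measurePreserving_vadd h μ).integrable_comp_of_integrable h1) h1,
        hint h hf, sub_self]
  have : CompleteSpace S := (Submodule.isClosed_topologicalClosure B).completeSpace_coe
  set g := F - S.starProjection F with hg
  have hgS : g ∈ Sᗮ := Submodule.sub_starProjection_mem_orthogonal F
  -- `U h g - g` lies in `S` because `S` is invariant and contains `U h F - F`, while `g` is
  -- orthogonal to `S`. As `U h` is an isometry, Pythagoras forces the difference to vanish.
  have hUg : ∀ h, U h g = g := by
    intro h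
    have h1 : U h g - g ∈ S := by
      have : U h g - g = (U h F - F) - (U h (S.starProjection F) - S.starProjection F) := by
        rw [hg, map_sub]
        abel
      rw [this]
      exact S.sub_mem (B.le_topologicalClosure (hUF h))
        (S.sub_mem (hUS h _ (Submodule.starProjection_apply_mem _ _))
          (Submodule.starProjection_apply_mem _ _))
    have h2 : inner ℝ (U h g - g) g = 0 := Submodule.inner_right_of_mem_orthogonal h1 hgS
    have h3 := norm_add_sq_eq_norm_sq_add_norm_sq_of_inner_eq_zero _ _ h2
    rw [sub_add_cancel, (U h).norm_map] at h3
    have h4 : ‖U h g - g‖ = 0 := by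
      have : ‖U h g - g‖ * ‖U h g - g‖ = 0 := by linarith
      exact mul_self_eq_zero.1 this
    exact sub_eq_zero.1 (norm_eq_zero.1 h4)
  obtain ⟨c, hc⟩ := ErgodicVAdd.exists_ae_eq_const (G := Fin d → ℤ) (μ := μ)
    (Lp.stronglyMeasurable g).measurable fun h => by
      have := hU h g
      rw [hUg h] at this
      exact this.symm
  refine ⟨c, ?_⟩
  have : Lp.const 2 μ c = g := Lp.ext ((Lp.coeFn_const ..).trans hc.symm)
  rw [this, hg, sub_sub_cancel]
  exact Submodule.starProjection_apply_mem _ _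

/-- Under an ergodic action of `ℤ^d`, a bounded function minus its mean is approximated in `L¹` by
functions all of whose averages over cubes tend to zero. -/
theorem exists_lintegral_sub_le_of_ergodicVAdd [ErgodicVAdd (Fin d → ℤ) X μ]
    (f : X → ℝ) (hf : Measurable f) {C : ℝ} (hC : ∀ x, |f x| ≤ C) {ε : ℝ} (hε : 0 < ε) :
    ∃ g : X → ℝ, Measurable g ∧
      (∀ x, Tendsto (fun n => cubeAverage (d := d) g n x) atTop (𝓝 0)) ∧
      ∫⁻ x, ENNReal.ofReal |f x - ∫ y, f y ∂μ - g x| ∂μ ≤ ENNReal.ofReal ε := by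
  have hf2 : MemLp f 2 μ := MemLp.of_bound hf.aestronglyMeasurable C (Eventually.of_forall hC)
  obtain ⟨c, hc⟩ := exists_sub_const_mem_closure_vanishingAverages (d := d) μ f hf hC hf2
  have key : ∀ ε > 0, ∃ g : X → ℝ, Measurable g ∧ Integrable g μ ∧ ∫ x, g x ∂μ = 0 ∧
      (∀ x, Tendsto (fun n => cubeAverage (d := d) g n x) atTop (𝓝 0)) ∧
      ∫⁻ x, ENNReal.ofReal |f x - c - g x| ∂μ ≤ ENNReal.ofReal ε := by
    intro ε hε
    obtain ⟨φ, ⟨g, hg, hφ, hg0, hgt⟩, hdist⟩ := Metric.mem_closure_iff.1 hc ε hε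
    refine ⟨g, hg, ((Lp.memLp φ).ae_eq hφ).integrable one_le_two, hg0, hgt, ?_⟩
    have hae : (hf2.toLp f - Lp.const 2 μ c - φ : Lp ℝ 2 μ) =ᵐ[μ] fun x => f x - c - g x := by
      filter_upwards [Lp.coeFn_sub (hf2.toLp f - Lp.const 2 μ c) φ,
        Lp.coeFn_sub (hf2.toLp f) (Lp.const 2 μ c), hf2.coeFn_toLp, hφ,
        Lp.coeFn_const 2 μ c] with x h1 h2 h3 h4 h5
      rw [h1, Pi.sub_apply, h2, Pi.sub_apply, h3, h4, h5, Function.const_apply]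
    rw [dist_eq_norm, Lp.norm_def, eLpNorm_congr_ae hae] at hdist
    have hm : AEStronglyMeasurable (fun x => f x - c - g x) μ :=
      ((hf.sub_const c).sub hg).aestronglyMeasurable
    have h12 := eLpNorm_le_eLpNorm_of_exponent_le (p := 1) (q := 2) one_le_two hm
    rw [eLpNorm_one_eq_lintegral_enorm] at h12
    simp only [Real.enorm_eq_ofReal_abs] at h12
    refine h12.trans ((ENNReal.le_ofReal_iff_toReal_le ?_ hε.le).2 hdist.le)
    rw [← eLpNorm_congr_ae hae]
    exact Lp.eLpNorm_ne_top _
  have hfi := hf2.integrable one_le_two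
  -- The approximants have mean zero, which identifies `c` as the mean of `f`.
  have hcf : ∫ y, f y ∂μ = c := by
    refine eq_of_abs_sub_le_all fun ε hε => ?_
    obtain ⟨g, -, hgi, hg0, -, hle⟩ := key ε hε
    have h1 : ∫ y, f y ∂μ - c = ∫ x, (f x - c - g x) ∂μ := by
      rw [integral_sub (f := fun x => f x - c) (hfi.sub (integrable_const c)) hgi, integral_sub hfi (integrable_const c),
        hg0]
      simp
    rw [h1, ← Real.norm_eq_abs, ← ENNReal.ofReal_le_ofReal_iff hε.le, ofReal_norm]
    refine (enorm_integral_le_lintegral_enorm _).trans ?_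
    simpa only [Real.enorm_eq_ofReal_abs] using hle
  obtain ⟨g, hg, -, -, hgt, hle⟩ := key ε hε
  exact ⟨g, hg, hgt, by rwa [hcf]⟩

/-- **Pointwise ergodic theorem** for bounded functions and averages over cubes, for an ergodic
action of `ℤ^d`. -/
theorem ae_tendsto_cubeAverage [ErgodicVAdd (Fin d → ℤ) X μ]
    (f : X → ℝ) (hf : Measurable f) {C : ℝ} (hC : ∀ x, |f x| ≤ C) :
    ∀ᵐ x ∂μ, Tendsto (fun n => cubeAverage (d := d) f n x) atTop (𝓝 (∫ y, f y ∂μ)) := by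
  set m := ∫ y, f y ∂μ
  have key : ∀ δ > 0, ∀ᵐ x ∂μ, ∀ᶠ n in atTop, |cubeAverage (d := d) f n x - m| ≤ 2 * δ := by
    intro δ hδ
    rw [ae_iff]
    set bad := {x | ¬ ∀ᶠ n in atTop, |cubeAverage (d := d) f n x - m| ≤ 2 * δ}
    have hbound : ∀ ε > 0, ENNReal.ofReal δ * μ bad ≤ 6 ^ d * ENNReal.ofReal ε := by
      intro ε hε
      obtain ⟨g, hg, hgt, hle⟩ := exists_lintegral_sub_le_of_ergodicVAdd (d := d) μ f hf hC hε
      -- One `δ` absorbs the averages of `g`, eventually small; the other must then be exceeded by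
      -- averages of the remainder infinitely often.
      have hsub : bad ⊆ {x | ∃ n, 0 < n ∧
          δ ≤ cubeAverage (d := d) (fun x => |f x - m - g x|) n x} := by
        intro x hx
        by_contra hcon
        refine hx ?_
        filter_upwards [eventually_gt_atTop 0,
          (hgt x).eventually_mem (Metric.closedBall_mem_nhds 0 hδ)] with n hn hgn
        have h1 : cubeAverage (d := d) (fun x => |f x - m - g x|) n x < δ :=
          not_le.1 fun h => hcon ⟨n, hn, h⟩
        have h2 := (abs_cubeAverage_le (d := d) (f - (fun _ => m) - g) n x).trans_lt h1
        rw [cubeAverage_sub, cubeAverage_sub, cubeAverage_const m hn] at h2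
        rw [Metric.mem_closedBall, dist_zero_right, Real.norm_eq_abs] at hgn
        rw [abs_le] at hgn ⊢
        rw [abs_lt] at h2
        constructor <;> linarith [h2.1, h2.2, hgn.1, hgn.2]
      refine (mul_le_mul_right (measure_mono hsub) _).trans
        ((mul_measure_exists_le_cubeAverage_le _ ?_ (fun x => abs_nonneg _) hδ.le).trans ?_)
      · exact (continuous_abs.measurable.comp ((hf.sub_const m).sub hg))
      · gcongr
    have hlim : Tendsto (fun ε : ℝ => 6 ^ d * ENNReal.ofReal ε) (𝓝[>] 0) (𝓝 0) := by
      have h1 : Tendsto (fun ε : ℝ => ENNReal.ofReal ε) (𝓝[>] 0) (𝓝 0) := by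
        have := (ENNReal.continuous_ofReal.tendsto 0).mono_left (nhdsWithin_le_nhds (s := Set.Ioi 0))
        rwa [ENNReal.ofReal_zero] at this
      have := ENNReal.Tendsto.const_mul (a := 6 ^ d) h1 (Or.inr (by finiteness))
      rwa [mul_zero] at this
    have h0 : ENNReal.ofReal δ * μ bad ≤ 0 :=
      ge_of_tendsto hlim (eventually_mem_nhdsWithin.mono fun ε hε => hbound ε hε)
    have h0' := (mul_eq_zero.1 (nonpos_iff_eq_zero.1 h0)).resolve_left
      (ENNReal.ofReal_pos.2 hδ).ne'
    exact h0'
  have hall : ∀ᵐ x ∂μ, ∀ k : ℕ, ∀ᶠ n in atTop,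
      |cubeAverage (d := d) f n x - m| ≤ 2 * (1 / ((k : ℝ) + 1)) :=
    ae_all_iff.2 fun k => key _ (by positivity)
  filter_upwards [hall] with x hx
  rw [Metric.tendsto_nhds]
  intro ε hε
  obtain ⟨k, hk⟩ := exists_nat_one_div_lt (half_pos hε)
  filter_upwards [hx k] with n hn
  rw [Real.dist_eq]
  linarith

end PointwiseErgodic

/-! ### Path space and the law of the field -/

/-- The space of paths `ℤ^d → ℝ`, acted on by `ℤ^d` through shifts. -/
def LatticePath (d : ℕ) : Type := (Fin d → ℤ) → ℝ

namespace LatticePath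

variable {d : ℕ}

instance : MeasurableSpace (LatticePath d) := MeasurableSpace.pi

instance : AddAction (Fin d → ℤ) (LatticePath d) where
  vadd h y := fun t => y (t + h)
  zero_vadd y := funext fun t => congrArg y (add_zero t)
  add_vadd h k y := funext fun t => congrArg y (add_assoc t h k).symm

theorem vadd_apply (h : Fin d → ℤ) (y : LatticePath d) (t : Fin d → ℤ) :
    (h +ᵥ y) t = y (t + h) := rfl

theorem measurable_eval (t : Fin d → ℤ) : Measurable fun y : LatticePath d => y t :=
  measurable_pi_apply (X := fun _ : Fin d → ℤ => ℝ) t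

instance : MeasurableConstVAdd (Fin d → ℤ) (LatticePath d) where
  measurable_const_vadd h :=
    measurable_pi_lambda (X := fun _ : Fin d → ℤ => ℝ) _ fun t => measurable_eval (t + h)

variable {Ω : Type*} [MeasurableSpace Ω] {P : Measure Ω} [IsProbabilityMeasure P]
  {Y : (Fin d → ℤ) → Ω → ℝ}

/-- The trajectory of the sample point `ω` under the random field `Y`. -/
def ofField (Y : (Fin d → ℤ) → Ω → ℝ) (ω : Ω) : LatticePath d := fun t => Y t ω

theorem measurable_ofField (hmeas : ∀ t, Measurable (Y t)) : Measurable (ofField Y) :=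
  measurable_pi_lambda (X := fun _ : Fin d → ℤ => ℝ) _ hmeas

/-- A finite measure on path space is determined by its finite dimensional marginals, which
stationarity makes equal. -/
theorem map_vadd_map_ofField (hmeas : ∀ t, Measurable (Y t)) (hstat : IsStationaryField P Y)
    (h : Fin d → ℤ) : (P.map (ofField Y)).map (h +ᵥ ·) = P.map (ofField Y) := by
  have hm := measurable_ofField hmeas
  rw [Measure.map_map (measurable_const_vadd h) hm]
  have hm' : Measurable ((fun y : LatticePath d => h +ᵥ y) ∘ ofField Y) :=
    (measurable_const_vadd h).comp hm
  let Q : (I : Finset (Fin d → ℤ)) → Measure ((t : I) → ℝ) := fun I =>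
    P.map (fun ω (t : I) => Y (t : Fin d → ℤ) ω)
  have : ∀ I, IsProbabilityMeasure (Q I) := fun I =>
    Measure.isProbabilityMeasure_map (measurable_pi_lambda _ fun t : I => hmeas t).aemeasurable
  refine IsProjectiveLimit.unique (ι := Fin d → ℤ) (α := fun _ => ℝ) (P := Q) (fun I => ?_)
    (fun I => ?_)
  · exact (Measure.map_map (Finset.measurable_restrict I) hm').trans (hstat h I)
  · exact Measure.map_map (Finset.measurable_restrict I) hm

/-- The law on path space of a stationary ergodic field is ergodic for the shift action. -/
theorem ergodicVAdd_map_ofField (hmeas : ∀ t, Measurable (Y t)) (hstat : IsStationaryField P Y)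
    (herg : IsErgodicField P Y) : ErgodicVAdd (Fin d → ℤ) (LatticePath d) (P.map (ofField Y)) where
  measure_preimage_vadd h s hs := by
    rw [← Measure.map_apply (measurable_const_vadd h) hs, map_vadd_map_ofField hmeas hstat]
  aeconst_of_forall_preimage_vadd_ae_eq {s} hs hinv := by
    have hm := measurable_ofField hmeas
    have : IsProbabilityMeasure (P.map (ofField Y)) :=
      Measure.isProbabilityMeasure_map hm.aemeasurable
    -- `IsErgodicField` speaks only of strictly invariant sets. As `ℤ^d` is countable, intersecting
    -- all translates of `s` gives one that agrees with `s` almost everywhere.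
    set A : Set (LatticePath d) := ⋂ h : Fin d → ℤ, (h +ᵥ ·) ⁻¹' s with hA
    have hAm : MeasurableSet A := MeasurableSet.iInter fun h => measurable_const_vadd h hs
    have hAs : A =ᵐ[P.map (ofField Y)] s := by
      have := Filter.EventuallyEq.countable_iInter hinv
      rwa [Set.iInter_const] at this
    have hAinv : ∀ h : Fin d → ℤ, (h +ᵥ ·) ⁻¹' A = A := by
      intro h
      rw [hA, Set.preimage_iInter]
      ext y
      simp only [Set.mem_iInter, Set.mem_preimage, ← add_vadd]
      exact ⟨fun H k => by simpa using H (k - h), fun H k => H (k + h)⟩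
    refine EventuallyConst.congr ?_ hAs
    have hPA : P.map (ofField Y) A = P {ω | (fun t => Y t ω) ∈ A} := Measure.map_apply hm hAm
    rcases herg A hAm hAinv with h0 | h1
    · exact eventuallyConst_set.2 (Or.inr (measure_eq_zero_iff_ae_notMem.1 (hPA.trans h0)))
    · exact eventuallyConst_set.2 (Or.inl ((prob_compl_eq_zero_iff hAm).2 (hPA.trans h1)))

end LatticePath

/-! ### Densities of the sampling sets -/

section SamplingSets

variable {d : ℕ} {Ω : Type*} {Y : (Fin d → ℤ) → Ω → ℝ}

theorem mem_sampleSet {n : ℕ} {ω : Ω} {t : Fin d → ℤ} :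
    t ∈ sampleSet Y n ω ↔ t ∈ latticeCube d n ∧ Y t ω = 1 := by
  simp [sampleSet, latticeCube]

theorem card_lag_pairs (Γ : Finset (Fin d → ℤ)) (l : Fin d → ℤ) :
    ((Γ ×ˢ Γ).filter (fun p => p.1 - p.2 = l)).card = (Γ.filter (fun s => s + l ∈ Γ)).card := by
  refine Finset.card_nbij' (fun p => p.2) (fun s => (s + l, s)) ?_ ?_ ?_ ?_
  · rintro ⟨t, s⟩ h
    simp only [Finset.coe_filter, Finset.mem_product, Set.mem_ofPred_eq] at h ⊢
    obtain ⟨⟨ht, hs⟩, rfl⟩ := h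
    simpa [hs] using ht
  · intro s h
    simp only [Finset.coe_filter, Finset.mem_product, Set.mem_ofPred_eq] at h ⊢
    exact ⟨⟨h.2, h.1⟩, by simp⟩
  · rintro ⟨t, s⟩ h
    simp only [Finset.coe_filter, Finset.mem_product, Set.mem_ofPred_eq] at h
    simp [← h.2]
  · intro s _
    rfl

variable [MeasurableSpace Ω]

open Classical in
/-- Almost surely, the density in `[-n, n)^d` of the sites `t` with `Y_t = Y_{t + l} = 1`
converges to `E[Y_l Y_0]`. -/
theorem ae_tendsto_density_pairs {P : Measure Ω} [IsProbabilityMeasure P]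
    (hmeas : ∀ t, Measurable (Y t)) (hval : ∀ t ω, Y t ω = 0 ∨ Y t ω = 1)
    (hstat : IsStationaryField P Y) (herg : IsErgodicField P Y) (l : Fin d → ℤ) :
    ∀ᵐ ω ∂P, Tendsto (fun n : ℕ =>
      (((latticeCube d n).filter (fun t => Y t ω = 1 ∧ Y (t + l) ω = 1)).card : ℝ) /
        (latticeCube d n).card) atTop (𝓝 (∫ ω', Y l ω' * Y 0 ω' ∂P)) := by
  have hm := LatticePath.measurable_ofField hmeas
  have := LatticePath.ergodicVAdd_map_ofField hmeas hstat herg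
  have : IsProbabilityMeasure (P.map (LatticePath.ofField Y)) :=
    Measure.isProbabilityMeasure_map hm.aemeasurable
  set s : Set (LatticePath d) := {y | y 0 = 1 ∧ y l = 1} with hs
  have hsm : MeasurableSet s :=
    ((LatticePath.measurable_eval 0) (measurableSet_singleton (1 : ℝ))).inter
      ((LatticePath.measurable_eval l) (measurableSet_singleton (1 : ℝ)))
  have hfm : Measurable (s.indicator (1 : LatticePath d → ℝ)) := measurable_one.indicator hsm
  have hlim := ae_tendsto_cubeAverage (d := d) (P.map (LatticePath.ofField Y))
    (s.indicator (1 : LatticePath d → ℝ)) hfm (C := 1) fun y => by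
      by_cases hy : y ∈ s <;> simp [hy]
  have hint : ∫ y, s.indicator (1 : LatticePath d → ℝ) y ∂(P.map (LatticePath.ofField Y)) =
      ∫ ω', Y l ω' * Y 0 ω' ∂P := by
    rw [integral_map hm.aemeasurable hfm.aestronglyMeasurable]
    refine integral_congr_ae (Eventually.of_forall fun ω => ?_)
    have hmem : LatticePath.ofField Y ω ∈ s ↔ Y 0 ω = 1 ∧ Y l ω = 1 := Iff.rfl
    simp only [Set.indicator_apply, hmem, Pi.one_apply]
    rcases hval 0 ω with h0 | h0 <;> rcases hval l ω with h1 | h1 <;> simp [h0, h1]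
  rw [hint] at hlim
  filter_upwards [ae_of_ae_map hm.aemeasurable hlim] with ω hω
  refine hω.congr fun n => ?_
  rw [cubeAverage]
  congr 1
  have hmem : ∀ t : Fin d → ℤ, t +ᵥ LatticePath.ofField Y ω ∈ s ↔ Y t ω = 1 ∧ Y (t + l) ω = 1 := by
    intro t
    simp only [hs, Set.mem_ofPred_eq, LatticePath.vadd_apply, LatticePath.ofField, zero_add,
      add_comm l]
  simp only [Set.indicator_apply, hmem, Pi.one_apply, Finset.sum_boole]

/-- Almost surely, the density of the sampling sets converges to `E[Y_0]`. -/
theorem ae_tendsto_card_sampleSet_div {P : Measure Ω} [IsProbabilityMeasure P]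
    (hmeas : ∀ t, Measurable (Y t)) (hval : ∀ t ω, Y t ω = 0 ∨ Y t ω = 1)
    (hstat : IsStationaryField P Y) (herg : IsErgodicField P Y) :
    ∀ᵐ ω ∂P, Tendsto (fun n : ℕ => ((sampleSet Y n ω).card : ℝ) / (latticeCube d n).card) atTop
      (𝓝 (∫ ω', Y 0 ω' ∂P)) := by
  classical
  have hint : ∫ ω', Y 0 ω' * Y 0 ω' ∂P = ∫ ω', Y 0 ω' ∂P := by
    congr 1
    ext ω
    rcases hval 0 ω with h | h <;> simp [h]
  filter_upwards [ae_tendsto_density_pairs hmeas hval hstat herg 0] with ω hω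
  rw [hint] at hω
  refine hω.congr fun n => ?_
  congr 3
  ext t
  simp [mem_sampleSet]

/-- Almost surely, the number of pairs of lag `l` in the sampling sets, relative to the volume of
the cube, converges to `E[Y_l Y_0]`. -/
theorem ae_tendsto_card_lag_pairs_div {P : Measure Ω} [IsProbabilityMeasure P]
    (hmeas : ∀ t, Measurable (Y t)) (hval : ∀ t ω, Y t ω = 0 ∨ Y t ω = 1)
    (hstat : IsStationaryField P Y) (herg : IsErgodicField P Y) (l : Fin d → ℤ) :
    ∀ᵐ ω ∂P, Tendsto (fun n : ℕ =>
      (((sampleSet Y n ω ×ˢ sampleSet Y n ω).filter (fun p => p.1 - p.2 = l)).card : ℝ) /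
        (latticeCube d n).card) atTop (𝓝 (∫ ω', Y l ω' * Y 0 ω' ∂P)) := by
  classical
  filter_upwards [ae_tendsto_density_pairs hmeas hval hstat herg l] with ω hω
  -- A site counted in `hω` yields no pair only if `t + l` leaves the cube; this gives the lower
  -- half of a squeeze.
  have hlow := hω.sub (tendsto_card_boundary_div l)
  rw [sub_zero] at hlow
  refine tendsto_of_tendsto_of_tendsto_of_le_of_le hlow hω (fun n => ?_) (fun n => ?_)
  · rw [← sub_div, card_lag_pairs]
    gcongr
    rw [sub_le_iff_le_add, ← Nat.cast_add, Nat.cast_le]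
    refine le_trans (Finset.card_le_card (t := _ ∪ _) fun t ht => ?_) (Finset.card_union_le
      {s ∈ sampleSet Y n ω | s + l ∈ sampleSet Y n ω}
      {t ∈ latticeCube d n | t + l ∉ latticeCube d n})
    simp only [Finset.mem_filter, Finset.mem_union, mem_sampleSet] at ht ⊢
    tauto
  · rw [card_lag_pairs]
    gcongr
    intro t ht
    simp only [Finset.mem_filter, mem_sampleSet] at ht ⊢
    tauto

end SamplingSets

theorem lemma3p4 {d : ℕ} (hd : 0 < d) {Ω : Type*} [MeasurableSpace Ω]
    (P : Measure Ω) [IsProbabilityMeasure P]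
    (Y : (Fin d → ℤ) → Ω → ℝ) (hmeas : ∀ t, Measurable (Y t))
    (hval : ∀ t ω, Y t ω = 0 ∨ Y t ω = 1)
    (hstat : IsStationaryField P Y) (herg : IsErgodicField P Y)
    (hmean : ∫ ω, Y 0 ω ∂P ≠ 0) :
    (∀ l : Fin d → ℤ, ∀ᵐ ω ∂P,
      Tendsto (fun n : ℕ => lagFreq (sampleSet Y n ω) l) atTop
        (𝓝 ((∫ ω', Y l ω' * Y 0 ω' ∂P) / ∫ ω', Y 0 ω' ∂P))) ∧
    ∀ᵐ ω ∂P, IsSamplingSequence (fun n : ℕ => sampleSet Y n ω) := by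
  have hcard0 : ∀ n : ℕ, 0 < n → ((latticeCube d n).card : ℝ) ≠ 0 := fun n hn => by
    rw [card_latticeCube]
    positivity
  have hdens := ae_tendsto_card_sampleSet_div hmeas hval hstat herg
  have hfreq : ∀ l : Fin d → ℤ, ∀ᵐ ω ∂P,
      Tendsto (fun n : ℕ => lagFreq (sampleSet Y n ω) l) atTop
        (𝓝 ((∫ ω', Y l ω' * Y 0 ω' ∂P) / ∫ ω', Y 0 ω' ∂P)) := by
    intro l
    filter_upwards [hdens, ae_tendsto_card_lag_pairs_div hmeas hval hstat herg l] with ω h1 h2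
    refine (h2.div h1 hmean).congr' ?_
    filter_upwards [eventually_gt_atTop 0] with n hn
    rw [Pi.div_apply, div_div_div_cancel_right₀ (hcard0 n hn), lagFreq]
  refine ⟨hfreq, ?_⟩
  filter_upwards [hdens, ae_all_iff.2 hfreq] with ω h1 h2
  refine ⟨fun n t ht => ?_, ?_, fun l => ⟨_, h2 l⟩⟩
  · rw [mem_sampleSet] at ht ⊢
    exact ⟨latticeCube_mono d n.le_succ ht.1, ht.2⟩
  · have hpos : 0 < ∫ ω', Y 0 ω' ∂P := by
      refine lt_of_le_of_ne (integral_nonneg fun ω' => ?_) hmean.symm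
      rcases hval 0 ω' with h | h <;> simp [h]
    -- Here `d > 0` is essential: for `d = 0` every cube is a single point.
    have hQ : Tendsto (fun n : ℕ => ((latticeCube d n).card : ℝ)) atTop atTop := by
      refine tendsto_natCast_atTop_atTop.comp (tendsto_atTop_mono (fun n => ?_) tendsto_id)
      rw [card_latticeCube]
      calc n ≤ 2 * n := by omega
        _ ≤ (2 * n) ^ d := Nat.le_self_pow hd.ne' _
    rw [← tendsto_natCast_atTop_iff (R := ℝ)]
    refine (h1.pos_mul_atTop hpos hQ).congr' ?_
    filter_upwards [eventually_gt_atTop 0] with n hn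
    exact div_mul_cancel₀ _ (hcard0 n hn)
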